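/- Let $K$ be a field and $X$ a finite connected poset with $|X|>1$ (connected: any two elements are joined by a finite sequence in which consecutive elements are comparable). Let $I(X,K)$ be the incidence algebra, with basis $e_{xy}$ ($x\le y$), product $e_{xy}e_{uv}=\delta_{yu}e_{xv}$, idempotents $e_x=e_{xx}$ and identity $\delta=\sum_x e_x$, considered as a Lie algebra under $[f,g]=fg-gf$. Let $J$ be its Jacobson radical and $Z(J)$ the center of $J$. Write $f=f_D+f_J$, where $f_D=\sum_x f(x,x)e_x$ is the diagonal part of $f$ and $f_J\in J$. For a unit $\beta$ put $\xi_\beta(f)=\beta f\beta^{-1}$. Let $\mathcal B=\{e_{xy}:x<y\}$ and fix an element $x_1\in X$. Consider triples $(\theta,\sigma,c)$ of the following kind. * $\theta:\mathcal B\to\mathcal B$ is a bijection which is monotone on maximal chains: for each maximal chain $u_1<\dots<u_m$ of $X$ there is a maximal chain $v_1<\dots<v_m$ such that either $\theta(e_{u_iu_j})=e_{v_iv_j}$ for all $i<j$, or $\theta(e_{u_iu_j})=e_{v_{m-j+1}v_{m-i+1}}$ for all $i<j$. * $\theta$ is admissible: for each closed walk $\Gamma:u_0,u_1,\dots,u_m=u_0$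 in the Hasse diagram of $X$ and each $z\in X$ one has $s^+-s^-=t^+-t^-$ in $K$. Here $s^+$ (resp. $s^-$) is the number of $i$ such that $u_i<u_{i+1}$ and $e_{u_iu_{i+1}}=\theta(e_{zw})$ for some $w>z$ (resp. $u_{i+1}<u_i$ and $e_{u_{i+1}u_i}=\theta(e_{zw})$ for some $w>z$), and $t^{\pm}$ are defined in the same way with $\theta(e_{wz})$, $w<z$, in place of $\theta(e_{zw})$, $w>z$. * $\sigma:\{(x,y):x<y\}\to K^*$ is compatible with $\theta$: for all $x<y<z$, $\sigma(x,z)=\sigma(x,y)\sigma(y,z)$ if $\theta(e_{xz})=\theta(e_{xy})\theta(e_{yz})$, and $\sigma(x,z)=-\sigma(x,y)\sigma(y,z)$ if $\theta(e_{xz})=\theta(e_{yz})\theta(e_{xy})$. * $c=(c_x)_{x\in X}\in K^X$ satisfies $\sum_{x}c_x\ne0$. For such a triple let $\tau_{\theta,\sigma,c}$ be the linear map on $I(X,K)$ with $\tau_{\theta,\sigma,c}(e_{xy})=\sigma(x,y)\theta(e_{xy})$ for $x<y$ and, for $z\in X$, with $\tau_{\theta,\sigma,c}(e_z)$ the unique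 diagonal element whose $(x_1,x_1)$ entry is $c_z$ and for which $[\tau_{\theta,\sigma,c}(e_z),\theta(e_{xy})]=(\delta_{zx}-\delta_{zy})\,\theta(e_{xy})$ for all $x<y$. A regular Hom-Lie structure on a Lie algebra $L$ is a Lie algebra automorphism $\varphi$ of $L$ such that $[[a,b],\varphi(c)]+[[b,c],\varphi(a)]+[[c,a],\varphi(b)]=0$ for all $a,b,c\in L$. **Theorem.** Let $\varphi$ be a Lie automorphism of $I(X,K)$. Then $\varphi$ is a regular Hom-Lie structure on $I(X,K)$ if and only if $\varphi=\xi_\beta\circ\tau_{\theta,\sigma,c}$ for some unit $\beta$ of $I(X,K)$ and some triple $(\theta,\sigma,c)$ as above such that 1. $\theta=\mathrm{id}_{\mathcal B}$; 2. $\sigma(x,y)=1$ unless $x$ is minimal and $y$ is maximal in $X$; 3. $\beta_D=\delta$ and $\beta_J\in Z(J)$. Moreover, such $\beta$, $\theta$, $\sigma$ and $c$ are unique. -/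

import Mathlib

attribute [local instance 100] LieRing.ofAssociativeRing

namespace IncHomLie

/-! ### Hom-Lie structures on a Lie algebra -/

section HomLie

variable {K L : Type*} [CommRing K] [LieRing L] [LieAlgebra K L]

/-- A linear map `φ : L → L` is a Hom-Lie structure on the Lie algebra `L` if it satisfies the
Hom-Jacobi identity. -/
def IsHomLieStructure (φ : L →ₗ[K] L) : Prop :=
  ∀ a b c : L, ⁅⁅a, b⁆, φ c⁆ + ⁅⁅b, c⁆, φ a⁆ + ⁅⁅c, a⁆, φ b⁆ = 0

/-- A regular Hom-Lie structure: a Hom-Lie structure which is an isomorphism of the Lie algebra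
`L` onto itself. -/
def IsRegularHomLieStructure (φ : L →ₗ[K] L) : Prop :=
  IsHomLieStructure φ ∧ (∀ a b : L, φ ⁅a, b⁆ = ⁅φ a, φ b⁆) ∧ Function.Bijective φ

end HomLie

/-! ### Posets -/

/-- Any two elements are joined by a finite sequence in which consecutive elements are
comparable. -/
def PosetConnected (X : Type*) [PartialOrder X] : Prop :=
  ∀ x y : X, Relation.ReflTransGen (fun a b : X => a ≤ b ∨ b ≤ a) x y

/-- The set `X²_<` of pairs `x < y`. It indexes the set `𝓑 = {e_xy : x < y}` through
`(x, y) ↦ e_xy`, so a bijection of `𝓑` is a permutation of `Lt2 X`. -/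
abbrev Lt2 (X : Type*) [PartialOrder X] : Type _ := {p : X × X // p.1 < p.2}

/-- The pair `(x, y)` of `X²_<`, or the element `e_xy` of `𝓑`. -/
abbrev Lt2.mk {X : Type*} [PartialOrder X] (x y : X) (h : x < y) : Lt2 X := ⟨(x, y), h⟩

section Theta

variable {X : Type*} [PartialOrder X]

/-- `u 0 < u 1 < ⋯ < u (m - 1)` is a maximal chain of `X`. -/
def IsMaximalChain {m : ℕ} (u : Fin m → X) : Prop :=
  StrictMono u ∧ IsMaxChain (· ≤ ·) (Set.range u)

/-- `θ` is increasing on the maximal chain `u`: there is a maximal chain `v` with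
`θ (e_{u_i u_j}) = e_{v_i v_j}` for all `i < j`. -/
def IncreasingOn (θ : Equiv.Perm (Lt2 X)) {m : ℕ} (u : Fin m → X) : Prop :=
  ∃ v : Fin m → X, IsMaximalChain v ∧
    ∀ i j : Fin m, i < j → ∀ h : u i < u j, (θ (Lt2.mk (u i) (u j) h)).1 = (v i, v j)

/-- `θ` is decreasing on the maximal chain `u`: there is a maximal chain `v` such that `θ` takes
`e_{u_i u_j}` to `e_{v_{m-j+1} v_{m-i+1}}` (indices from `1` to `m`) for all `i < j`. -/
def DecreasingOn (θ : Equiv.Perm (Lt2 X)) {m : ℕ} (u : Fin m → X) : Prop :=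
  ∃ v : Fin m → X, IsMaximalChain v ∧
    ∀ i j : Fin m, i < j → ∀ h : u i < u j, (θ (Lt2.mk (u i) (u j) h)).1 = (v j.rev, v i.rev)

/-- `θ` is monotone on maximal chains in `X`. -/
def MonotoneOnMaxChains (θ : Equiv.Perm (Lt2 X)) : Prop :=
  ∀ (m : ℕ) (u : Fin m → X), IsMaximalChain u → IncreasingOn θ u ∨ DecreasingOn θ u

open Classical in
/-- The number of steps `u_i < u_{i+1}` of the walk such that `e_{u_i u_{i+1}} = θ (e_zw)` for
some `w > z`. -/
noncomputable def sPlus (θ : Equiv.Perm (Lt2 X)) {a b : X}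
    (Γ : (SimpleGraph.hasse X).Walk a b) (z : X) : ℕ :=
  Γ.darts.countP fun d =>
    d.fst < d.snd ∧ ∃ (w : X) (h : z < w), (θ (Lt2.mk z w h)).1 = (d.fst, d.snd)

open Classical in
/-- The number of steps `u_i > u_{i+1}` of the walk such that `e_{u_{i+1} u_i} = θ (e_zw)` for
some `w > z`. -/
noncomputable def sMinus (θ : Equiv.Perm (Lt2 X)) {a b : X}
    (Γ : (SimpleGraph.hasse X).Walk a b) (z : X) : ℕ :=
  Γ.darts.countP fun d =>
    d.snd < d.fst ∧ ∃ (w : X) (h : z < w), (θ (Lt2.mk z w h)).1 = (d.snd, d.fst)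

open Classical in
/-- The number of steps `u_i < u_{i+1}` of the walk such that `e_{u_i u_{i+1}} = θ (e_wz)` for
some `w < z`. -/
noncomputable def tPlus (θ : Equiv.Perm (Lt2 X)) {a b : X}
    (Γ : (SimpleGraph.hasse X).Walk a b) (z : X) : ℕ :=
  Γ.darts.countP fun d =>
    d.fst < d.snd ∧ ∃ (w : X) (h : w < z), (θ (Lt2.mk w z h)).1 = (d.fst, d.snd)

open Classical in
/-- The number of steps `u_i > u_{i+1}` of the walk such that `e_{u_{i+1} u_i} = θ (e_wz)` for
some `w < z`. -/
noncomputable def tMinus (θ : Equiv.Perm (Lt2 X)) {a b : X}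
    (Γ : (SimpleGraph.hasse X).Walk a b) (z : X) : ℕ :=
  Γ.darts.countP fun d =>
    d.snd < d.fst ∧ ∃ (w : X) (h : w < z), (θ (Lt2.mk w z h)).1 = (d.snd, d.fst)

/-- `θ` is admissible: `s⁺ - s⁻ = t⁺ - t⁻` (in `K`) for every closed walk in the Hasse diagram of
`X` and every `z`. For `θ` monotone on maximal chains of a finite connected poset this is the
condition under which the images of the idempotents `e_z` under `tau` below exist. -/
def Admissible (K : Type*) [Field K] (θ : Equiv.Perm (Lt2 X)) : Prop :=
  ∀ (a : X) (Γ : (SimpleGraph.hasse X).Walk a a) (z : X),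
    (sPlus θ Γ z : K) - (sMinus θ Γ z : K) = (tPlus θ Γ z : K) - (tMinus θ Γ z : K)

end Theta

/-! ### The incidence algebra -/

section Algebra

variable {K X : Type*} [Field K] [PartialOrder X] [DecidableEq X]

/-- The basis element `e_xy`, for `p = (x, y)` with `x < y`. -/
def basisElt (K : Type*) [Field K] (p : Lt2 X) : IncidenceAlgebra K X where
  toFun u v := if p.1 = (u, v) then 1 else 0
  eq_zero_of_not_le' u v h := if_neg fun e => h (by
    have hp := p.2
    rw [e] at hp
    exact hp.le)

/-- The diagonal element with diagonal entries `d`. -/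
def diagElt (d : X → K) : IncidenceAlgebra K X where
  toFun u v := if u = v then d u else 0
  eq_zero_of_not_le' _ _ h := if_neg fun e => h e.le

/-- The diagonal component `f_D` of `f`. -/
def diagPart (f : IncidenceAlgebra K X) : IncidenceAlgebra K X := diagElt fun x => f x x

/-- The component `f_J = f - f_D` of `f`. -/
def radPart (f : IncidenceAlgebra K X) : IncidenceAlgebra K X := f - diagPart f

variable [LocallyFiniteOrder X]

/-- The center `Z(J)` of the Jacobson radical `J` of the incidence algebra. -/
def radicalCenter (K X : Type*) [Field K] [PartialOrder X] [DecidableEq X]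
    [LocallyFiniteOrder X] : Set (IncidenceAlgebra K X) :=
  {a | a ∈ Ring.jacobson (IncidenceAlgebra K X) ∧
    ∀ b ∈ Ring.jacobson (IncidenceAlgebra K X), a * b = b * a}

/-- The inner automorphism `ξ_β (f) = β f β⁻¹`, as a linear map. -/
def xi (β : (IncidenceAlgebra K X)ˣ) : IncidenceAlgebra K X →ₗ[K] IncidenceAlgebra K X :=
  LinearMap.mulLeft K (β : IncidenceAlgebra K X) ∘ₗ
    LinearMap.mulRight K ((β⁻¹ : (IncidenceAlgebra K X)ˣ) : IncidenceAlgebra K X)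

/-- `σ : X²_< → K*` is compatible with `θ`. -/
def Compatible (θ : Equiv.Perm (Lt2 X)) (σ : Lt2 X → Kˣ) : Prop :=
  ∀ (x y z : X) (hxy : x < y) (hyz : y < z),
    (basisElt K (θ (.mk x z (hxy.trans hyz))) =
        basisElt K (θ (.mk x y hxy)) * basisElt K (θ (.mk y z hyz)) →
      σ (.mk x z (hxy.trans hyz)) = σ (.mk x y hxy) * σ (.mk y z hyz)) ∧
    (basisElt K (θ (.mk x z (hxy.trans hyz))) =
        basisElt K (θ (.mk y z hyz)) * basisElt K (θ (.mk x y hxy)) →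
      σ (.mk x z (hxy.trans hyz)) = -(σ (.mk x y hxy) * σ (.mk y z hyz)))

/-- The conditions that determine the diagonal entries `d` of `τ (e_z)`: the entry at `x₁` is
`c z`, and `[τ (e_z), θ (e_xy)] = (δ_{zx} - δ_{zy}) θ (e_xy)` for all `x < y`, which is what the
preservation of the commutators `[e_z, e_xy] = (δ_{zx} - δ_{zy}) e_xy` requires. On a connected
poset they have at most one solution. -/
def IsTauDiag (x₁ : X) (θ : Equiv.Perm (Lt2 X)) (c : X → K) (z : X) (d : X → K) : Prop :=
  d x₁ = c z ∧ ∀ p : Lt2 X,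
    ⁅diagElt d, basisElt K (θ p)⁆ =
      ((if z = p.1.1 then 1 else 0) - (if z = p.1.2 then 1 else 0) : K) • basisElt K (θ p)

/-- The diagonal entries of `τ (e_z)`, determined by `IsTauDiag`. -/
noncomputable def tauDiag (x₁ : X) (θ : Equiv.Perm (Lt2 X)) (c : X → K) (z : X) : X → K :=
  Classical.epsilon (IsTauDiag x₁ θ c z)

variable [Fintype X]

/-- The parameters of an elementary Lie automorphism `τ_{θ,σ,c}`: an admissible bijection `θ` of
`𝓑` which is monotone on maximal chains, a map `σ` compatible with `θ`, and a family `c` of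
scalars whose sum is nonzero. -/
def IsElementaryDatum (θ : Equiv.Perm (Lt2 X)) (σ : Lt2 X → Kˣ) (c : X → K) : Prop :=
  Admissible K θ ∧ MonotoneOnMaxChains θ ∧ Compatible θ σ ∧ ∑ x, c x ≠ 0

open Classical in
/-- The linear map `τ_{θ,σ,c}`: it takes `e_xy` to `σ(x,y) θ(e_xy)` for `x < y`, and `e_z` to the
diagonal element determined by `τ(e_z)(x₁,x₁) = c z`, where `x₁` is the chosen base element
(the first one in an enumeration) of `X`. -/
noncomputable def tau (x₁ : X) (θ : Equiv.Perm (Lt2 X)) (σ : Lt2 X → Kˣ) (c : X → K) :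
    IncidenceAlgebra K X →ₗ[K] IncidenceAlgebra K X where
  toFun f := ∑ p : Lt2 X, (f p.1.1 p.1.2 * (σ p : K)) • basisElt K (θ p) +
    ∑ z : X, f z z • diagElt (tauDiag x₁ θ c z)
  map_add' f g := by
    simp only [IncidenceAlgebra.add_apply, add_mul, add_smul, Finset.sum_add_distrib]
    abel
  map_smul' r f := by
    simp only [IncidenceAlgebra.constSMul_apply, smul_eq_mul, mul_assoc, mul_smul,
      RingHom.id_apply, smul_add, Finset.smul_sum]

/-- The quadruple `(β, θ, σ, c)` represents `φ` as `ξ_β ∘ τ_{θ,σ,c}`, where `θ` is the identity,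
`σ(x,y) = 1` unless `x` is minimal and `y` is maximal, `β_D = δ` and `β_J ∈ Z(J)`. -/
def IsHomLieRepresentation (x₁ : X) (φ : IncidenceAlgebra K X →ₗ[K] IncidenceAlgebra K X)
    (β : (IncidenceAlgebra K X)ˣ) (θ : Equiv.Perm (Lt2 X)) (σ : Lt2 X → Kˣ) (c : X → K) : Prop :=
  IsElementaryDatum θ σ c ∧
  φ = xi β ∘ₗ tau x₁ θ σ c ∧
  θ = Equiv.refl (Lt2 X) ∧
  (∀ p : Lt2 X, ¬ (IsMin p.1.1 ∧ IsMax p.1.2) → σ p = 1) ∧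
  diagPart (β : IncidenceAlgebra K X) = 1 ∧
  radPart (β : IncidenceAlgebra K X) ∈ radicalCenter K X

end Algebra

end IncHomLie

open IncHomLie

namespace IncHomLie

variable {K X : Type*} [Field K] [PartialOrder X] [DecidableEq X]

/-! Call an element extremal if it is supported on pairs (u, v) with u < v, u minimal and v maximal.
Products of an extremal element with an element of zero diagonal vanish in either order, the
extremal elements form Z(J), and conjugation by 1 + b with b extremal is f ↦ f + [b, f].

Sufficiency. For θ = id, τ adds one scalar to the whole diagonal of f and rescales only extremal
entries. So φ f - f is the sum of a scalar, an extremal element and a bracket with an extremal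
element, and each of these commutes with every element of zero diagonal. Commutators have zero
diagonal, so the Hom-Jacobi identity for φ is the Jacobi identity
(`IsHomLieRepresentation.lie_apply_eq`).

Necessity. Hom-Jacobi on two idempotents and e_xy shows that the diagonal of φ(e_w) differs at x and
y as that of e_w does, up to a factor t depending only on x < y. Bijectivity forces t = 1
(`map_idem_weight`), and connectedness then makes this diagonal that of e_w plus a scalar. The same
identities kill the non-extremal entries above the diagonal (`map_idem_apply_eq_zero`), and since
the φ(e_w) commute, their extremal entries are those of [b, e_w] for a single extremal b. Hence
φ(e_xy) has the weight of e_xy and is a multiple of it (`map_basisElt_eq`). Hom-Jacobi along x < y <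
z makes the multiples at (x, y) and (y, z) equal to 1 (`map_basisElt_coeff`).

Uniqueness holds because β, σ and c can be read off the entries of φ(e_v) and φ(e_xy). -/

theorem basisElt_apply (p : Lt2 X) (u v : X) :
    basisElt K p u v = if p.1 = (u, v) then 1 else 0 := rfl

theorem diagElt_apply (d : X → K) (u v : X) :
    diagElt d u v = if u = v then d u else 0 := rfl

theorem diagElt_self (d : X → K) (u : X) : diagElt d u u = d u := if_pos rfl

theorem diagPart_apply (f : IncidenceAlgebra K X) (u v : X) :
    diagPart f u v = if u = v then f u u else 0 := rfl

theorem diagPart_add_radPart (f : IncidenceAlgebra K X) : diagPart f + radPart f = f := by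
  simp [radPart]

theorem basisElt_self (p : Lt2 X) : basisElt K p p.1.1 p.1.2 = 1 := if_pos rfl

theorem basisElt_diag (p : Lt2 X) (u : X) : basisElt K p u u = 0 :=
  if_neg fun h => p.2.ne (by rw [h])

theorem basisElt_ne_zero (p : Lt2 X) : basisElt K p ≠ 0 := fun h => by
  have := basisElt_self (K := K) p
  rw [h] at this
  exact zero_ne_one this

/-- The idempotent `e_z`. -/
def idem (K : Type*) [Field K] {X : Type*} [PartialOrder X] [DecidableEq X] (z : X) :
    IncidenceAlgebra K X :=
  diagElt fun u => if z = u then 1 else 0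

omit [DecidableEq X] in
theorem ext_lt_diag {f g : IncidenceAlgebra K X} (hd : ∀ x, f x x = g x x)
    (hl : ∀ x y, x < y → f x y = g x y) : f = g := by
  ext x y h
  rcases h.eq_or_lt with rfl | h
  · exact hd x
  · exact hl x y h

/-! ### Products and commutators in the incidence algebra -/

section Mul

variable [LocallyFiniteOrder X]

omit [DecidableEq X] in
theorem mul_apply_self (f g : IncidenceAlgebra K X) (x : X) : (f * g) x x = f x x * g x x := by
  simp

theorem lie_apply_self (f g : IncidenceAlgebra K X) (x : X) : ⁅f, g⁆ x x = 0 := by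
  rw [Ring.lie_def, IncidenceAlgebra.sub_apply, mul_apply_self, mul_apply_self]
  ring

theorem lie_apply (f g : IncidenceAlgebra K X) (x y : X) :
    ⁅f, g⁆ x y = (f * g) x y - (g * f) x y := rfl

theorem diagElt_mul_apply (d : X → K) (f : IncidenceAlgebra K X) (u v : X) :
    (diagElt d * f) u v = d u * f u v := by
  by_cases h : u ≤ v
  · rw [IncidenceAlgebra.mul_apply, Finset.sum_eq_single u]
    · rw [diagElt_self]
    · intro b _ hb
      rw [diagElt_apply, if_neg hb.symm, zero_mul]
    · simp [h]
  · rw [IncidenceAlgebra.apply_eq_zero_of_not_le h, IncidenceAlgebra.apply_eq_zero_of_not_le h,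
      mul_zero]

theorem mul_diagElt_apply (d : X → K) (f : IncidenceAlgebra K X) (u v : X) :
    (f * diagElt d) u v = f u v * d v := by
  by_cases h : u ≤ v
  · rw [IncidenceAlgebra.mul_apply, Finset.sum_eq_single v]
    · rw [diagElt_self]
    · intro b _ hb
      rw [diagElt_apply, if_neg hb, mul_zero]
    · simp [h]
  · rw [IncidenceAlgebra.apply_eq_zero_of_not_le h, IncidenceAlgebra.apply_eq_zero_of_not_le h,
      zero_mul]

theorem idem_lie_apply (z : X) (f : IncidenceAlgebra K X) (u v : X) :
    ⁅idem K z, f⁆ u v = ((if z = u then 1 else 0) - (if z = v then 1 else 0)) * f u v := by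
  rw [lie_apply, idem, diagElt_mul_apply, mul_diagElt_apply]
  ring

theorem basisElt_mul_apply (p : Lt2 X) (f : IncidenceAlgebra K X) (u v : X) :
    (basisElt K p * f) u v = if p.1.1 = u then f p.1.2 v else 0 := by
  have key : ∀ x, basisElt K p u x * f x v = if p.1.2 = x then
      (if p.1.1 = u then f p.1.2 v else 0) else 0 := by
    intro x
    rw [basisElt_apply]
    obtain ⟨⟨a, b⟩, h⟩ := p
    simp only [Prod.mk.injEq]
    split_ifs <;> simp_all
  rw [IncidenceAlgebra.mul_apply, Finset.sum_congr rfl fun x _ => key x, Finset.sum_ite_eq]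
  split_ifs with h1 h2 h2
  · rfl
  · rfl
  · symm
    apply IncidenceAlgebra.apply_eq_zero_of_not_le
    intro h3
    exact h1 (Finset.mem_Icc.2 ⟨h2 ▸ p.2.le, h3⟩)
  · rfl

theorem mul_basisElt_apply (p : Lt2 X) (f : IncidenceAlgebra K X) (u v : X) :
    (f * basisElt K p) u v = if p.1.2 = v then f u p.1.1 else 0 := by
  have key : ∀ x, f u x * basisElt K p x v = if p.1.1 = x then
      (if p.1.2 = v then f u p.1.1 else 0) else 0 := by
    intro x
    rw [basisElt_apply]
    obtain ⟨⟨a, b⟩, h⟩ := p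
    simp only [Prod.mk.injEq]
    split_ifs <;> simp_all
  rw [IncidenceAlgebra.mul_apply, Finset.sum_congr rfl fun x _ => key x, Finset.sum_ite_eq]
  split_ifs with h1 h2 h2
  · rfl
  · rfl
  · symm
    apply IncidenceAlgebra.apply_eq_zero_of_not_le
    intro h3
    exact h1 (Finset.mem_Icc.2 ⟨h3, h2 ▸ p.2.le⟩)
  · rfl

theorem basisElt_lie_apply (p : Lt2 X) (f : IncidenceAlgebra K X) (u v : X) :
    ⁅basisElt K p, f⁆ u v =
      (if p.1.1 = u then f p.1.2 v else 0) - (if p.1.2 = v then f u p.1.1 else 0) := by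
  rw [lie_apply, basisElt_mul_apply, mul_basisElt_apply]

theorem diagElt_lie_basisElt (d : X → K) (p : Lt2 X) :
    ⁅diagElt d, basisElt K p⁆ = (d p.1.1 - d p.1.2) • basisElt K p := by
  ext u v _
  rw [lie_apply, diagElt_mul_apply, mul_diagElt_apply, IncidenceAlgebra.constSMul_apply,
    basisElt_apply]
  split_ifs with h
  · rw [h]; simp
  · simp

theorem idem_lie_basisElt (z : X) (p : Lt2 X) :
    ⁅idem K z, basisElt K p⁆ =
      ((if z = p.1.1 then 1 else 0) - (if z = p.1.2 then 1 else 0) : K) • basisElt K p :=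
  diagElt_lie_basisElt _ p

theorem idem_lie_idem (z w : X) : ⁅idem K z, idem K w⁆ = 0 := by
  ext u v _
  rw [idem_lie_apply, idem, diagElt_apply, IncidenceAlgebra.zero_apply]
  by_cases h : u = v
  · subst h; simp
  · simp [h]

/-! ### The Jacobson radical -/

/-- The diagonal entry at `x`, as a ring homomorphism. -/
def diagEntry (K : Type*) [Field K] {X : Type*} [PartialOrder X] [DecidableEq X]
    [LocallyFiniteOrder X] (x : X) : IncidenceAlgebra K X →+* K where
  toFun f := f x x
  map_one' := by simp
  map_mul' f g := mul_apply_self f g x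
  map_zero' := rfl
  map_add' _ _ := rfl

/-- A surjective ring homomorphism maps the radical into the radical, and the radical of the field K
is zero. -/
theorem apply_self_eq_zero_of_mem_jacobson {f : IncidenceAlgebra K X}
    (hf : f ∈ Ring.jacobson (IncidenceAlgebra K X)) (x : X) : f x x = 0 := by
  have hs : Function.Surjective (diagEntry K x) := fun a =>
    ⟨diagElt fun _ => a, diagElt_self (fun _ => a) x⟩
  have : RingHomSurjective (diagEntry K x) := ⟨hs⟩
  have h := Ring.le_comap_jacobson (diagEntry K x) hf
  rw [Ideal.mem_comap, IsSemisimpleRing.jacobson_eq_bot, Ideal.mem_bot] at h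
  exact h

theorem mem_jacobson_of_mul_mul_self_eq_zero {R : Type*} [Ring R] {x : R}
    (h : ∀ y, x * y * x = 0) : x ∈ Ring.jacobson R := by
  rw [← Ideal.jacobson_bot, Ideal.mem_jacobson_iff]
  intro y
  -- This is the inverse of 1 + y x, because (y x)² = y (x y x) = 0.
  refine ⟨1 - y * x, ?_⟩
  have : (1 - y * x) * y * x + (1 - y * x) - 1 = -(y * (x * y * x)) := by noncomm_ring
  rw [this, h, mul_zero, neg_zero]
  exact Submodule.zero_mem _

theorem basisElt_mem_jacobson (p : Lt2 X) :
    basisElt K p ∈ Ring.jacobson (IncidenceAlgebra K X) := by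
  refine mem_jacobson_of_mul_mul_self_eq_zero fun f => ?_
  ext u v _
  rw [mul_basisElt_apply, basisElt_mul_apply, IncidenceAlgebra.zero_apply,
    IncidenceAlgebra.apply_eq_zero_of_not_le p.2.not_ge]
  simp

/-- The support of `f` consists of pairs `(u, v)` with `u < v`, `u` minimal and `v` maximal. -/
def ExtremalSupport (f : IncidenceAlgebra K X) : Prop :=
  ∀ u v, f u v ≠ 0 → u < v ∧ IsMin u ∧ IsMax v

omit [DecidableEq X] [LocallyFiniteOrder X] in
theorem ExtremalSupport.apply_self {f : IncidenceAlgebra K X} (hf : ExtremalSupport f) (x : X) :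
    f x x = 0 := by
  by_contra h
  exact lt_irrefl _ (hf x x h).1

omit [DecidableEq X] in
-- In a nonzero term b(u,s) j(s,v) the element s is maximal, so s = v and the term contains a
-- diagonal entry of j.
theorem ExtremalSupport.mul_eq_zero {b j : IncidenceAlgebra K X} (hb : ExtremalSupport b)
    (hj : ∀ x, j x x = 0) : b * j = 0 := by
  ext u v _
  rw [IncidenceAlgebra.mul_apply, IncidenceAlgebra.zero_apply]
  refine Finset.sum_eq_zero fun s hs => ?_
  by_contra h
  have h1 := (hb u s (left_ne_zero_of_mul h)).2.2
  have h2 : s = v := (Finset.mem_Icc.1 hs).2.antisymm (h1 (Finset.mem_Icc.1 hs).2)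
  subst h2
  rw [hj, mul_zero] at h
  exact h rfl

omit [DecidableEq X] in
theorem ExtremalSupport.mul_eq_zero' {b j : IncidenceAlgebra K X} (hb : ExtremalSupport b)
    (hj : ∀ x, j x x = 0) : j * b = 0 := by
  ext u v _
  rw [IncidenceAlgebra.mul_apply, IncidenceAlgebra.zero_apply]
  refine Finset.sum_eq_zero fun s hs => ?_
  by_contra h
  have h1 := (hb s v (right_ne_zero_of_mul h)).2.1
  have h2 : u = s := (Finset.mem_Icc.1 hs).1.antisymm (h1 (Finset.mem_Icc.1 hs).1)
  subst h2
  rw [hj, zero_mul] at h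
  exact h rfl

omit [DecidableEq X] in
theorem mul_self_diag {f g : IncidenceAlgebra K X} (hf : ∀ x, f x x = 0) (x : X) :
    (f * g) x x = 0 ∧ (g * f) x x = 0 := by
  rw [mul_apply_self, mul_apply_self, hf]
  simp

omit [DecidableEq X] in
theorem ExtremalSupport.mul_mul_self_eq_zero {b : IncidenceAlgebra K X} (hb : ExtremalSupport b)
    (f : IncidenceAlgebra K X) : b * f * b = 0 :=
  hb.mul_eq_zero' fun x => (mul_self_diag hb.apply_self x).1

omit [DecidableEq X] in
theorem ExtremalSupport.mul_self_eq_zero {b : IncidenceAlgebra K X} (hb : ExtremalSupport b) :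
    b * b = 0 :=
  hb.mul_eq_zero hb.apply_self

/-- If w < u, commuting with e_wu at the entry (w, v) kills b(u, v); if v < w, commuting with e_vw
at (u, w) does. Conversely, radical elements have zero diagonal, so extremal elements annihilate
them on both sides. -/
theorem mem_radicalCenter_iff {b : IncidenceAlgebra K X} :
    b ∈ radicalCenter K X ↔ ExtremalSupport b := by
  constructor
  · rintro ⟨hb, hc⟩ u v h
    have huv : u < v := by
      refine (IncidenceAlgebra.le_of_ne_zero h).lt_of_ne ?_
      rintro rfl
      exact h (apply_self_eq_zero_of_mem_jacobson hb u)
    refine ⟨huv, ?_, ?_⟩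
    · rw [isMin_iff_forall_not_lt]
      intro w hw
      have := congrArg (fun f : IncidenceAlgebra K X => f w v)
        (hc _ (basisElt_mem_jacobson (.mk w u hw)))
      simp only [mul_basisElt_apply, basisElt_mul_apply, if_neg huv.ne, if_true] at this
      exact h this.symm
    · rw [isMax_iff_forall_not_lt]
      intro w hw
      have := congrArg (fun f : IncidenceAlgebra K X => f u w)
        (hc _ (basisElt_mem_jacobson (.mk v w hw)))
      simp only [mul_basisElt_apply, basisElt_mul_apply, if_neg huv.ne', if_true] at this
      exact h this
  · intro hb
    refine ⟨mem_jacobson_of_mul_mul_self_eq_zero hb.mul_mul_self_eq_zero, fun j hj => ?_⟩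
    rw [hb.mul_eq_zero (apply_self_eq_zero_of_mem_jacobson hj),
      hb.mul_eq_zero' (apply_self_eq_zero_of_mem_jacobson hj)]

/-- The unit `1 + b`, for `b` with extremal support. -/
def ExtremalSupport.unit {b : IncidenceAlgebra K X} (hb : ExtremalSupport b) :
    (IncidenceAlgebra K X)ˣ where
  val := 1 + b
  inv := 1 - b
  val_inv := by
    have : (1 + b) * (1 - b) = 1 - b * b := by noncomm_ring
    rw [this, hb.mul_self_eq_zero, sub_zero]
  inv_val := by
    have : (1 - b) * (1 + b) = 1 - b * b := by noncomm_ring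
    rw [this, hb.mul_self_eq_zero, sub_zero]

theorem ExtremalSupport.xi_eq {b : IncidenceAlgebra K X} (hb : ExtremalSupport b)
    {β : (IncidenceAlgebra K X)ˣ} (hβ : (β : IncidenceAlgebra K X) = 1 + b)
    (f : IncidenceAlgebra K X) : xi β f = f + ⁅b, f⁆ := by
  have : β = hb.unit := Units.ext hβ
  subst this
  change (1 + b) * (f * (1 - b)) = _
  have : (1 + b) * (f * (1 - b)) = f + (b * f - f * b) - b * f * b := by noncomm_ring
  rw [this, hb.mul_mul_self_eq_zero, sub_zero, Ring.lie_def]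

end Mul

/-! ### The identity bijection is monotone and admissible; connectedness -/

section Identity

variable {X : Type*} [PartialOrder X]

theorem monotoneOnMaxChains_refl : MonotoneOnMaxChains (Equiv.refl (Lt2 X)) :=
  fun _ u hu => Or.inl ⟨u, hu, fun _ _ _ _ => rfl⟩

open Classical in
-- Departures from z and arrivals at z alternate along a walk, so only the endpoints contribute a
-- difference.
theorem walk_darts_count {V : Type*} {G : SimpleGraph V} {a b : V} (Γ : G.Walk a b) (z : V) :
    Γ.darts.countP (fun d => d.fst = z) + (if b = z then 1 else 0) =
      Γ.darts.countP (fun d => d.snd = z) + (if a = z then 1 else 0) := by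
  induction Γ with
  | nil => rfl
  | cons h p ih =>
    rw [SimpleGraph.Walk.darts_cons, List.countP_cons, List.countP_cons]
    simp only [decide_eq_true_eq]
    omega

theorem exists_refl_right (z u v : X) :
    (∃ (w : X) (h : z < w), ((Equiv.refl (Lt2 X)) (Lt2.mk z w h)).1 = (u, v)) ↔ z = u ∧ u < v := by
  constructor
  · rintro ⟨w, h, e⟩
    obtain ⟨rfl, rfl⟩ := Prod.mk.inj e
    exact ⟨rfl, h⟩
  · rintro ⟨rfl, h⟩
    exact ⟨v, h, rfl⟩

theorem exists_refl_left (z u v : X) :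
    (∃ (w : X) (h : w < z), ((Equiv.refl (Lt2 X)) (Lt2.mk w z h)).1 = (u, v)) ↔ z = v ∧ u < v := by
  constructor
  · rintro ⟨w, h, e⟩
    obtain ⟨rfl, rfl⟩ := Prod.mk.inj e
    exact ⟨rfl, h⟩
  · rintro ⟨rfl, h⟩
    exact ⟨u, h, rfl⟩

open Classical in
-- For the identity, s⁺ counts the upward steps leaving z and t⁻ the downward ones. The companion
-- lemma treats arrivals, and a closed walk has as many of one as of the other.
theorem sPlus_add_tMinus_refl {a b : X} (Γ : (SimpleGraph.hasse X).Walk a b) (z : X) :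
    sPlus (Equiv.refl (Lt2 X)) Γ z + tMinus (Equiv.refl (Lt2 X)) Γ z =
      Γ.darts.countP (fun d => d.fst = z) := by
  rw [sPlus, tMinus]
  simp only [exists_refl_right, exists_refl_left]
  induction Γ.darts with
  | nil => rfl
  | cons d l ih =>
    rw [List.countP_cons, List.countP_cons, List.countP_cons, ← ih]
    have : d.fst < d.snd ∨ d.snd < d.fst :=
      (SimpleGraph.hasse_adj.1 d.adj).imp CovBy.lt CovBy.lt
    rcases this with h | h
    · simp only [h, h.not_gt, decide_eq_true_eq, true_and, and_true, false_and, if_false,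
        eq_comm (a := z)]
      omega
    · simp only [h, h.not_gt, decide_eq_true_eq, true_and, and_true, false_and, if_false,
        eq_comm (a := z)]
      omega

open Classical in
theorem sMinus_add_tPlus_refl {a b : X} (Γ : (SimpleGraph.hasse X).Walk a b) (z : X) :
    sMinus (Equiv.refl (Lt2 X)) Γ z + tPlus (Equiv.refl (Lt2 X)) Γ z =
      Γ.darts.countP (fun d => d.snd = z) := by
  rw [sMinus, tPlus]
  simp only [exists_refl_right, exists_refl_left]
  induction Γ.darts with
  | nil => rfl
  | cons d l ih =>
    rw [List.countP_cons, List.countP_cons, List.countP_cons, ← ih]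
    have : d.fst < d.snd ∨ d.snd < d.fst :=
      (SimpleGraph.hasse_adj.1 d.adj).imp CovBy.lt CovBy.lt
    rcases this with h | h
    · simp only [h, h.not_gt, decide_eq_true_eq, true_and, and_true, false_and, if_false,
        eq_comm (a := z)]
      omega
    · simp only [h, h.not_gt, decide_eq_true_eq, true_and, and_true, false_and, if_false,
        eq_comm (a := z)]
      omega

theorem admissible_refl (K : Type*) [Field K] : Admissible K (Equiv.refl (Lt2 X)) := by
  classical
  intro a Γ z
  have h : sPlus (Equiv.refl (Lt2 X)) Γ z + tMinus (Equiv.refl (Lt2 X)) Γ z =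
      sMinus (Equiv.refl (Lt2 X)) Γ z + tPlus (Equiv.refl (Lt2 X)) Γ z := by
    rw [sPlus_add_tMinus_refl, sMinus_add_tPlus_refl]
    exact Nat.add_right_cancel (walk_darts_count Γ z)
  have h' := congrArg (Nat.cast : ℕ → K) h
  push_cast at h'
  linear_combination h'

theorem PosetConnected.eq_of_lt {α : Type*} (hX : PosetConnected X) {d : X → α}
    (h : ∀ x y, x < y → d x = d y) (x y : X) : d x = d y := by
  induction hX x y with
  | refl => rfl
  | tail _ hbc ih =>
    rw [ih]
    rcases hbc with hbc | hbc <;> rcases hbc.eq_or_lt with rfl | hlt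
    · rfl
    · exact h _ _ hlt
    · rfl
    · exact (h _ _ hlt).symm

end Identity

/-! ### The map τ for the identity bijection -/

section Tau

variable {K X : Type*} [Field K] [PartialOrder X] [DecidableEq X] [LocallyFiniteOrder X]

/-- The bracket conditions say that d minus the diagonal of e_z agrees on comparable elements, so it
is constant on X; the entry at x₁ fixes the constant. -/
theorem isTauDiag_refl_iff (hX : PosetConnected X) (x₁ : X) (c : X → K) (z : X) (d : X → K) :
    IsTauDiag x₁ (Equiv.refl (Lt2 X)) c z d ↔
      d = fun u => c z + (if z = u then 1 else 0) - (if z = x₁ then 1 else 0) := by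
  have key : ∀ p : Lt2 X, (⁅diagElt d, basisElt K (Equiv.refl (Lt2 X) p)⁆ =
      ((if z = p.1.1 then 1 else 0) - (if z = p.1.2 then 1 else 0) : K) •
        basisElt K (Equiv.refl (Lt2 X) p)) ↔
      d p.1.1 - d p.1.2 = (if z = p.1.1 then 1 else 0) - (if z = p.1.2 then 1 else 0) := by
    intro p
    rw [Equiv.refl_apply, diagElt_lie_basisElt]
    exact ⟨fun h => smul_left_injective K (basisElt_ne_zero p) h, fun h => by rw [h]⟩
  rw [IsTauDiag, forall_congr' key]
  constructor
  · rintro ⟨h1, h2⟩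
    funext u
    have := hX.eq_of_lt (d := fun u => d u - if z = u then 1 else 0)
      (fun x y hxy => by
        have := h2 (.mk x y hxy)
        dsimp only at this ⊢
        linear_combination this) u x₁
    linear_combination this + h1
  · rintro rfl
    exact ⟨by ring, fun p => by ring⟩

theorem tauDiag_refl (hX : PosetConnected X) (x₁ : X) (c : X → K) (z : X) :
    tauDiag x₁ (Equiv.refl (Lt2 X)) c z =
      fun u => c z + (if z = u then 1 else 0) - (if z = x₁ then 1 else 0) :=
  (isTauDiag_refl_iff hX x₁ c z _).1
    (Classical.epsilon_spec ⟨_, (isTauDiag_refl_iff hX x₁ c z _).2 rfl⟩)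

/-- The clause with the sign is vacuous, since e_yz e_xy = 0 ≠ e_xz. -/
theorem compatible_refl_iff (σ : Lt2 X → Kˣ) :
    Compatible (Equiv.refl (Lt2 X)) σ ↔ ∀ (x y z : X) (hxy : x < y) (hyz : y < z),
      σ (.mk x z (hxy.trans hyz)) = σ (.mk x y hxy) * σ (.mk y z hyz) := by
  refine forall₅_congr fun x y z hxy hyz => ?_
  have h1 : basisElt K (.mk x z (hxy.trans hyz)) =
      basisElt K (.mk x y hxy) * basisElt K (.mk y z hyz) := by
    ext u v _
    rw [basisElt_mul_apply, basisElt_apply, basisElt_apply]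
    by_cases h : x = u <;> simp [h]
  have h2 : basisElt K (.mk x z (hxy.trans hyz)) ≠
      basisElt K (.mk y z hyz) * basisElt K (.mk x y hxy) := by
    intro h
    have := congrArg (fun f : IncidenceAlgebra K X => f x z) h
    simp only [basisElt_mul_apply, basisElt_apply, if_true, if_neg hxy.ne'] at this
    exact one_ne_zero this
  exact ⟨fun h => h.1 h1, fun h => ⟨fun _ => h, fun h' => absurd h' h2⟩⟩

variable [Fintype X]

omit [DecidableEq X] [LocallyFiniteOrder X] [Fintype X] in
theorem sum_apply {ι : Type*} (s : Finset ι) (f : ι → IncidenceAlgebra K X) (u v : X) :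
    (∑ i ∈ s, f i) u v = ∑ i ∈ s, f i u v := by
  classical
  induction s using Finset.induction_on with
  | empty => rfl
  | insert a s ha ih =>
    rw [Finset.sum_insert ha, Finset.sum_insert ha, IncidenceAlgebra.add_apply, ih]

theorem tau_refl_apply_of_lt (x₁ : X) (σ : Lt2 X → Kˣ) (c : X → K) (f : IncidenceAlgebra K X)
    {u v : X} (h : u < v) :
    tau x₁ (Equiv.refl (Lt2 X)) σ c f u v = f u v * σ (.mk u v h) := by
  classical
  change (_ + _ : IncidenceAlgebra K X) u v = _
  rw [IncidenceAlgebra.add_apply, sum_apply, sum_apply,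
    Finset.sum_eq_single (Lt2.mk u v h), Finset.sum_eq_zero, add_zero]
  · rw [IncidenceAlgebra.constSMul_apply, Equiv.refl_apply, basisElt_self (Lt2.mk u v h),
      smul_eq_mul, mul_one]
  · intro z _
    rw [IncidenceAlgebra.constSMul_apply, diagElt_apply, if_neg h.ne, smul_zero]
  · intro p _ hp
    rw [IncidenceAlgebra.constSMul_apply, Equiv.refl_apply, basisElt_apply,
      if_neg fun h => hp (Subtype.ext h), smul_zero]
  · intro h
    exact absurd (Finset.mem_univ _) h

/-- What matters later is that the correction in parentheses does not depend on u: on diagonals τ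
adds a scalar multiple of the identity. -/
theorem tau_refl_apply_self (hX : PosetConnected X) (x₁ : X) (σ : Lt2 X → Kˣ) (c : X → K)
    (f : IncidenceAlgebra K X) (u : X) :
    tau x₁ (Equiv.refl (Lt2 X)) σ c f u u = f u u + (∑ z, f z z * c z - f x₁ x₁) := by
  classical
  change (_ + _ : IncidenceAlgebra K X) u u = _
  rw [IncidenceAlgebra.add_apply, sum_apply, sum_apply, Finset.sum_eq_zero, zero_add]
  · simp only [IncidenceAlgebra.constSMul_apply, diagElt_self, tauDiag_refl hX, smul_eq_mul]
    simp only [mul_add, mul_sub, mul_ite, mul_one, mul_zero, Finset.sum_add_distrib,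
      Finset.sum_sub_distrib, Finset.sum_ite_eq', Finset.mem_univ, if_true]
    ring
  · intro p _
    rw [IncidenceAlgebra.constSMul_apply, Equiv.refl_apply, basisElt_diag, smul_zero]

theorem tau_refl_basisElt (x₁ : X) (σ : Lt2 X → Kˣ) (c : X → K) (hX : PosetConnected X)
    (p : Lt2 X) :
    tau x₁ (Equiv.refl (Lt2 X)) σ c (basisElt K p) = (σ p : K) • basisElt K p := by
  refine ext_lt_diag (fun x => ?_) fun x y h => ?_
  · simp [tau_refl_apply_self hX, IncidenceAlgebra.constSMul_apply, basisElt_diag]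
  · rw [tau_refl_apply_of_lt _ _ _ _ h, IncidenceAlgebra.constSMul_apply, basisElt_apply]
    split_ifs with hp
    · have : p = .mk x y h := Subtype.ext hp
      subst this; simp
    · simp

theorem tau_refl_idem (hX : PosetConnected X) (x₁ : X) (σ : Lt2 X → Kˣ) (c : X → K) (z : X) :
    tau x₁ (Equiv.refl (Lt2 X)) σ c (idem K z) =
      idem K z + (c z - if z = x₁ then 1 else 0) • (1 : IncidenceAlgebra K X) := by
  refine ext_lt_diag (fun x => ?_) fun x y h => ?_
  · simp [tau_refl_apply_self hX, idem, diagElt_self, IncidenceAlgebra.add_apply,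
      IncidenceAlgebra.constSMul_apply]
  · rw [tau_refl_apply_of_lt _ _ _ _ h]
    simp [idem, diagElt_apply, IncidenceAlgebra.add_apply,
      IncidenceAlgebra.constSMul_apply, h.ne]

end Tau

/-! ### Maps of the required form: uniqueness and the Hom-Jacobi identity -/

section Representation

variable {K X : Type*} [Field K] [PartialOrder X] [DecidableEq X] [LocallyFiniteOrder X]

theorem ExtremalSupport.lie_eq_zero {b j : IncidenceAlgebra K X} (hb : ExtremalSupport b)
    (hj : ∀ x, j x x = 0) : ⁅b, j⁆ = 0 := by
  rw [Ring.lie_def, hb.mul_eq_zero hj, hb.mul_eq_zero' hj, sub_zero]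

/-- By the Jacobi identity this is [[j, b], g] + [b, [j, g]], and [j, g] again has zero diagonal. -/
theorem ExtremalSupport.lie_lie_eq_zero {b j : IncidenceAlgebra K X} (hb : ExtremalSupport b)
    (hj : ∀ x, j x x = 0) (g : IncidenceAlgebra K X) : ⁅j, ⁅b, g⁆⁆ = 0 := by
  have h1 : ⁅b, ⁅j, g⁆⁆ = 0 := hb.lie_eq_zero (lie_apply_self j g)
  rw [leibniz_lie, h1, ← lie_skew j b, hb.lie_eq_zero hj]
  simp

variable [Fintype X]

variable {x₁ : X} {φ : IncidenceAlgebra K X →ₗ[K] IncidenceAlgebra K X}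
  {β : (IncidenceAlgebra K X)ˣ} {θ : Equiv.Perm (Lt2 X)} {σ : Lt2 X → Kˣ} {c : X → K}

theorem IsHomLieRepresentation.extremalSupport (h : IsHomLieRepresentation x₁ φ β θ σ c) :
    ExtremalSupport (radPart (β : IncidenceAlgebra K X)) :=
  mem_radicalCenter_iff.1 h.2.2.2.2.2

theorem IsHomLieRepresentation.unit_eq (h : IsHomLieRepresentation x₁ φ β θ σ c) :
    (β : IncidenceAlgebra K X) = 1 + radPart (β : IncidenceAlgebra K X) := by
  conv_lhs => rw [← diagPart_add_radPart (β : IncidenceAlgebra K X), h.2.2.2.2.1]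

theorem IsHomLieRepresentation.apply_eq (h : IsHomLieRepresentation x₁ φ β θ σ c)
    (f : IncidenceAlgebra K X) :
    φ f = tau x₁ (Equiv.refl (Lt2 X)) σ c f +
      ⁅radPart (β : IncidenceAlgebra K X), tau x₁ (Equiv.refl (Lt2 X)) σ c f⁆ := by
  rw [← h.extremalSupport.xi_eq h.unit_eq, ← h.2.2.1]
  exact congrArg (fun g : IncidenceAlgebra K X →ₗ[K] IncidenceAlgebra K X => g f) h.2.1

theorem IsHomLieRepresentation.apply_basisElt (hX : PosetConnected X)
    (h : IsHomLieRepresentation x₁ φ β θ σ c) (p : Lt2 X) :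
    φ (basisElt K p) = (σ p : K) • basisElt K p := by
  rw [h.apply_eq, tau_refl_basisElt _ _ _ hX, h.extremalSupport.lie_eq_zero, add_zero]
  intro x
  rw [IncidenceAlgebra.constSMul_apply, basisElt_diag, smul_zero]

omit [Fintype X] in
theorem lie_smul_one (a : K) (f : IncidenceAlgebra K X) :
    ⁅f, a • (1 : IncidenceAlgebra K X)⁆ = 0 := by
  rw [Ring.lie_def, mul_smul_one, smul_one_mul, sub_self]

theorem IsHomLieRepresentation.apply_idem (hX : PosetConnected X)
    (h : IsHomLieRepresentation x₁ φ β θ σ c) (z : X) :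
    φ (idem K z) = idem K z + (c z - if z = x₁ then 1 else 0) • (1 : IncidenceAlgebra K X) +
      ⁅radPart (β : IncidenceAlgebra K X), idem K z⁆ := by
  rw [h.apply_eq, tau_refl_idem hX, lie_add, lie_smul_one, add_zero]

theorem IsHomLieRepresentation.apply_idem_base (hX : PosetConnected X)
    (h : IsHomLieRepresentation x₁ φ β θ σ c) (z : X) : φ (idem K z) x₁ x₁ = c z := by
  rw [h.apply_idem hX, IncidenceAlgebra.add_apply, IncidenceAlgebra.add_apply, lie_apply_self,
    IncidenceAlgebra.constSMul_apply, idem, diagElt_self]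
  simp

theorem IsHomLieRepresentation.apply_idem_right (hX : PosetConnected X)
    (h : IsHomLieRepresentation x₁ φ β θ σ c) {u v : X} (huv : u < v) :
    φ (idem K v) u v = radPart (β : IncidenceAlgebra K X) u v := by
  rw [h.apply_idem hX, ← lie_skew, IncidenceAlgebra.add_apply, IncidenceAlgebra.neg_apply,
    idem_lie_apply, IncidenceAlgebra.add_apply, IncidenceAlgebra.constSMul_apply, idem,
    diagElt_apply, IncidenceAlgebra.one_apply, if_neg huv.ne, if_neg huv.ne, if_neg huv.ne']
  simp

theorem IsHomLieRepresentation.unique (hX : PosetConnected X)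
    {β' : (IncidenceAlgebra K X)ˣ} {θ' : Equiv.Perm (Lt2 X)} {σ' : Lt2 X → Kˣ} {c' : X → K}
    (h : IsHomLieRepresentation x₁ φ β θ σ c) (h' : IsHomLieRepresentation x₁ φ β' θ' σ' c') :
    β = β' ∧ θ = θ' ∧ σ = σ' ∧ c = c' := by
  refine ⟨?_, h.2.2.1.trans h'.2.2.1.symm, ?_, ?_⟩
  · apply Units.ext
    rw [h.unit_eq, h'.unit_eq]
    congr 1
    refine ext_lt_diag (fun x => ?_) fun u v huv => ?_
    · rw [h.extremalSupport.apply_self, h'.extremalSupport.apply_self]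
    · rw [← h.apply_idem_right hX huv, ← h'.apply_idem_right hX huv]
  · funext p
    apply Units.ext
    apply smul_left_injective K (basisElt_ne_zero (K := K) p)
    dsimp only
    rw [← h.apply_basisElt hX, ← h'.apply_basisElt hX]
  · funext z
    rw [← h.apply_idem_base hX, ← h'.apply_idem_base hX]

theorem IsHomLieRepresentation.lie_apply_eq (hX : PosetConnected X)
    (h : IsHomLieRepresentation x₁ φ β θ σ c) {j : IncidenceAlgebra K X}
    (hj : ∀ x, j x x = 0) (f : IncidenceAlgebra K X) : ⁅j, φ f⁆ = ⁅j, f⁆ := by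
  set g := tau x₁ (Equiv.refl (Lt2 X)) σ c f with hg
  obtain ⟨k, hk⟩ : ∃ k : K, ∀ x, g x x = f x x + k := ⟨_, tau_refl_apply_self hX x₁ σ c f⟩
  -- Off the diagonal g differs from f only where σ ≠ 1, hence only at extremal pairs.
  have hm : ExtremalSupport (g - f - k • (1 : IncidenceAlgebra K X)) := by
    intro u v huv
    rw [IncidenceAlgebra.sub_apply, IncidenceAlgebra.sub_apply, IncidenceAlgebra.constSMul_apply,
      IncidenceAlgebra.one_apply] at huv
    by_cases hle : u ≤ v
    · rcases hle.eq_or_lt with rfl | hlt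
      · rw [hk, if_pos rfl, smul_eq_mul] at huv
        exact absurd (by ring) huv
      · refine ⟨hlt, ?_⟩
        by_contra hext
        rw [hg, tau_refl_apply_of_lt _ _ _ _ hlt, h.2.2.2.1 (.mk u v hlt) hext,
          if_neg hlt.ne] at huv
        simp at huv
    · rw [IncidenceAlgebra.apply_eq_zero_of_not_le hle,
        IncidenceAlgebra.apply_eq_zero_of_not_le hle, if_neg fun e => hle e.le] at huv
      simp at huv
  have hgm : g = f + k • (1 : IncidenceAlgebra K X) +
      (g - f - k • (1 : IncidenceAlgebra K X)) := by abel
  have hjm : ⁅j, g - f - k • (1 : IncidenceAlgebra K X)⁆ = 0 := by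
    rw [← lie_skew, hm.lie_eq_zero hj, neg_zero]
  rw [h.apply_eq, ← hg, lie_add, h.extremalSupport.lie_lie_eq_zero hj, add_zero]
  conv_lhs => rw [hgm]
  rw [lie_add, lie_add, lie_smul_one, hjm, add_zero, add_zero]

theorem IsHomLieRepresentation.isHomLieStructure (hX : PosetConnected X)
    (h : IsHomLieRepresentation x₁ φ β θ σ c) : IsHomLieStructure φ := by
  intro a b d
  rw [h.lie_apply_eq hX (lie_apply_self _ _), h.lie_apply_eq hX (lie_apply_self _ _),
    h.lie_apply_eq hX (lie_apply_self _ _)]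
  simp only [Ring.lie_def]
  noncomm_ring

end Representation

/-! ### Weights under the idempotents, and the basis of the algebra -/

section Weights

variable {K X : Type*} [Field K] [PartialOrder X] [DecidableEq X] [LocallyFiniteOrder X]

/-- The elements supported on intervals that contain `[x, y]` form an ideal, on which bracketing
with `f` multiplies the entry at `(x, y)` by `f x x - f y y`. -/
theorem lie_of_support_contains {x y : X} {g : IncidenceAlgebra K X}
    (hg : ∀ s t, g s t ≠ 0 → s ≤ x ∧ y ≤ t) (f : IncidenceAlgebra K X) :
    (∀ s t, ⁅f, g⁆ s t ≠ 0 → s ≤ x ∧ y ≤ t) ∧ ⁅f, g⁆ x y = (f x x - f y y) * g x y := by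
  constructor
  · intro s t hst
    rw [lie_apply] at hst
    by_cases h1 : (f * g) s t = 0
    · rw [h1, zero_sub, neg_ne_zero, IncidenceAlgebra.mul_apply] at hst
      obtain ⟨r, hr, hne⟩ := Finset.exists_ne_zero_of_sum_ne_zero hst
      have := hg _ _ (left_ne_zero_of_mul hne)
      exact ⟨this.1, this.2.trans (Finset.mem_Icc.1 hr).2⟩
    · rw [IncidenceAlgebra.mul_apply] at h1
      obtain ⟨r, hr, hne⟩ := Finset.exists_ne_zero_of_sum_ne_zero h1
      have := hg _ _ (right_ne_zero_of_mul hne)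
      exact ⟨(Finset.mem_Icc.1 hr).1.trans this.1, this.2⟩
  · by_cases hxy : x ≤ y
    · rw [lie_apply, IncidenceAlgebra.mul_apply, IncidenceAlgebra.mul_apply,
        Finset.sum_eq_single x, Finset.sum_eq_single y]
      · ring
      · intro r hr hne
        by_contra h
        exact hne ((Finset.mem_Icc.1 hr).2.antisymm (hg _ _ (left_ne_zero_of_mul h)).2)
      · simp [hxy]
      · intro r hr hne
        by_contra h
        exact hne ((hg _ _ (right_ne_zero_of_mul h)).1.antisymm (Finset.mem_Icc.1 hr).1)
      · simp [hxy]
    · rw [IncidenceAlgebra.apply_eq_zero_of_not_le hxy, IncidenceAlgebra.apply_eq_zero_of_not_le hxy,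
        mul_zero]

omit [LocallyFiniteOrder X] in
theorem support_basisElt (p : Lt2 X) :
    ∀ s t, basisElt K p s t ≠ 0 → s ≤ p.1.1 ∧ p.1.2 ≤ t := by
  intro s t h
  rw [basisElt_apply] at h
  have : p.1 = (s, t) := by
    by_contra hne
    exact h (if_neg hne)
  rw [this]
  exact ⟨le_rfl, le_rfl⟩

theorem basisElt_lie_basisElt {x y z : X} (hxy : x < y) (hyz : y < z) :
    ⁅basisElt K (.mk x y hxy), basisElt K (.mk y z hyz)⁆ =
      basisElt K (.mk x z (hxy.trans hyz)) := by
  ext u v _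
  rw [basisElt_lie_apply, basisElt_apply, basisElt_apply, basisElt_apply]
  have h : ¬ (Lt2.mk y z hyz).1 = (u, x) := fun h => (hxy.trans hyz).ne' (Prod.mk.inj h).2
  by_cases hx : x = u <;> simp [hx] <;> rintro rfl rfl <;> exact fun h' => absurd h' (by simp_all)

variable [Fintype X]

theorem sum_basisElt_add_sum_idem (f : IncidenceAlgebra K X) [Fintype (Lt2 X)] :
    f = ∑ p : Lt2 X, f p.1.1 p.1.2 • basisElt K p + ∑ z : X, f z z • idem K z := by
  refine ext_lt_diag (fun x => ?_) fun x y h => ?_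
  · rw [IncidenceAlgebra.add_apply, sum_apply, sum_apply, Finset.sum_eq_zero,
      Finset.sum_eq_single x]
    · simp [idem, diagElt_self, IncidenceAlgebra.constSMul_apply]
    · intro z _ hz
      simp [idem, diagElt_self, IncidenceAlgebra.constSMul_apply, hz]
    · simp
    · intro p _
      rw [IncidenceAlgebra.constSMul_apply, basisElt_diag, smul_zero]
  · rw [IncidenceAlgebra.add_apply, sum_apply, sum_apply,
      Finset.sum_eq_single (Lt2.mk x y h), Finset.sum_eq_zero, add_zero]
    · rw [IncidenceAlgebra.constSMul_apply, basisElt_self (Lt2.mk x y h), smul_eq_mul, mul_one]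
    · intro z _
      rw [IncidenceAlgebra.constSMul_apply, idem, diagElt_apply, if_neg h.ne, smul_zero]
    · intro p _ hp
      rw [IncidenceAlgebra.constSMul_apply, basisElt_apply,
        if_neg fun h => hp (Subtype.ext h), smul_zero]
    · intro h
      exact absurd (Finset.mem_univ _) h

theorem linearMap_ext {f g : IncidenceAlgebra K X →ₗ[K] IncidenceAlgebra K X}
    (hb : ∀ p, f (basisElt K p) = g (basisElt K p)) (hi : ∀ z, f (idem K z) = g (idem K z)) :
    f = g := by
  classical
  ext1 a
  rw [sum_basisElt_add_sum_idem a]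
  simp only [map_add, map_sum, map_smul, hb, hi]

end Weights

/-! ### Automorphisms satisfying the Hom-Jacobi identity -/

section HomLieAutomorphism

variable {K X : Type*} [Field K] [PartialOrder X] [DecidableEq X] [LocallyFiniteOrder X]
  {φ : IncidenceAlgebra K X ≃ₗ⁅K⁆ IncidenceAlgebra K X}

/-- In Hom-Jacobi for e_x, e_w, e_xy, two of the inner brackets vanish. With w = y only one does,
which gives the relation of the next lemma. -/
theorem basisElt_lie_map_idem_of_ne
    (hφ : ∀ a b c, ⁅⁅a, b⁆, φ c⁆ + ⁅⁅b, c⁆, φ a⁆ + ⁅⁅c, a⁆, φ b⁆ = 0) {x y w : X} (hxy : x < y)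
    (hx : w ≠ x) (hy : w ≠ y) : ⁅basisElt K (.mk x y hxy), φ (idem K w)⁆ = 0 := by
  have h := hφ (idem K x) (idem K w) (basisElt K (.mk x y hxy))
  rw [idem_lie_idem, zero_lie, idem_lie_basisElt, ← lie_skew _ (idem K x), idem_lie_basisElt] at h
  rw [if_neg hx, if_neg hy, if_pos rfl, if_neg hxy.ne, sub_zero, sub_zero, zero_smul, zero_lie,
    one_smul, neg_lie, zero_add, zero_add, neg_eq_zero] at h
  exact h

theorem basisElt_lie_map_idem_add
    (hφ : ∀ a b c, ⁅⁅a, b⁆, φ c⁆ + ⁅⁅b, c⁆, φ a⁆ + ⁅⁅c, a⁆, φ b⁆ = 0) {x y : X} (hxy : x < y) :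
    ⁅basisElt K (.mk x y hxy), φ (idem K x)⁆ + ⁅basisElt K (.mk x y hxy), φ (idem K y)⁆ = 0 := by
  have h := hφ (idem K x) (idem K y) (basisElt K (.mk x y hxy))
  rw [idem_lie_idem, zero_lie, idem_lie_basisElt, ← lie_skew _ (idem K x), idem_lie_basisElt] at h
  simp only [hxy.ne, hxy.ne', if_true, if_false, zero_sub, sub_zero, neg_smul, one_smul, neg_lie,
    zero_add] at h
  rw [← neg_add, neg_eq_zero] at h
  exact h

theorem map_idem_diag_sub
    (hφ : ∀ a b c, ⁅⁅a, b⁆, φ c⁆ + ⁅⁅b, c⁆, φ a⁆ + ⁅⁅c, a⁆, φ b⁆ = 0) {x y : X} (hxy : x < y)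
    (w : X) : φ (idem K w) x x - φ (idem K w) y y =
      (φ (idem K x) x x - φ (idem K x) y y) *
        ((if w = x then 1 else 0) - (if w = y then 1 else 0)) := by
  by_cases hx : w = x
  · subst hx; simp [hxy.ne]
  by_cases hy : w = y
  · subst hy
    have h := congrArg (fun f : IncidenceAlgebra K X => f x w) (basisElt_lie_map_idem_add hφ hxy)
    simp only [IncidenceAlgebra.add_apply, basisElt_lie_apply, IncidenceAlgebra.zero_apply,
      if_true] at h
    simp only [hx, if_true, if_false]
    linear_combination -h
  · have h := congrArg (fun f : IncidenceAlgebra K X => f x y)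
      (basisElt_lie_map_idem_of_ne hφ hxy hx hy)
    simp only [basisElt_lie_apply, IncidenceAlgebra.zero_apply, if_true] at h
    simp only [hx, hy, if_false]
    linear_combination -h

theorem apply_self_of_lie_eq_self {f : IncidenceAlgebra K X} {g : IncidenceAlgebra K X}
    (h : ⁅g, f⁆ = f) (x : X) : f x x = 0 := by
  rw [← h, lie_apply_self]

theorem idem_lie_idem_lie_apply {u v : X} (huv : u < v) {f : IncidenceAlgebra K X}
    (hf : ∀ x, f x x = 0) (s t : X) :
    ⁅idem K v, ⁅idem K u, f⁆⁆ s t = if u = s ∧ v = t then -f u v else 0 := by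
  rw [idem_lie_apply, idem_lie_apply]
  by_cases hst : s < t
  · by_cases h1 : u = s
    · subst h1
      by_cases h2 : v = t
      · subst h2; simp [huv.ne, huv.ne']
      · simp [h2, huv.ne']
    · by_cases h3 : u = t
      · subst h3
        simp [(hst.trans huv).ne', huv.ne', h1]
      · simp [h1, h3]
  · have h0 : f s t = 0 := by
      by_cases hle : s ≤ t
      · obtain rfl : s = t := by_contra fun hne => hst (hle.lt_of_ne hne)
        exact hf s
      · exact IncidenceAlgebra.apply_eq_zero_of_not_le hle f
    have h1 : ¬ (u = s ∧ v = t) := by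
      rintro ⟨rfl, rfl⟩
      exact hst huv
    rw [h0, if_neg h1]
    ring

/-- The double bracket at (u, v) isolates -f(u,v) e_uv. Writing components by brackets lets a Lie
automorphism be applied to them. -/
theorem eq_sum_idem_lie_idem_lie [Fintype (Lt2 X)] {f : IncidenceAlgebra K X}
    (hf : ∀ x, f x x = 0) :
    f = -∑ q : Lt2 X, ⁅idem K q.1.2, ⁅idem K q.1.1, f⁆⁆ := by
  refine ext_lt_diag (fun x => ?_) fun x y h => ?_
  · rw [hf, IncidenceAlgebra.neg_apply, sum_apply, Finset.sum_eq_zero, neg_zero]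
    intro q _
    exact lie_apply_self _ _ _
  · rw [IncidenceAlgebra.neg_apply, sum_apply, Finset.sum_eq_single (Lt2.mk x y h),
      idem_lie_idem_lie_apply h hf]
    · simp
    · intro q _ hq
      rw [idem_lie_idem_lie_apply q.2 hf, if_neg]
      exact fun h => hq (Subtype.ext (Prod.ext h.1 h.2))
    · intro h
      exact absurd (Finset.mem_univ _) h

/-- Pull E = e_xy back to f = φ⁻¹(E). On the ideal generated by intervals containing [x, y], φ(e_u)
acts on the (x, y) entry by t(δ_ux - δ_uy), so relations among brackets of f with idempotents become
equations in t. -/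
theorem map_idem_weight [Fintype X]
    (hφ : ∀ a b c, ⁅⁅a, b⁆, φ c⁆ + ⁅⁅b, c⁆, φ a⁆ + ⁅⁅c, a⁆, φ b⁆ = 0) {x y : X} (hxy : x < y) :
    φ (idem K x) x x - φ (idem K x) y y = 1 := by
  classical
  set t := φ (idem K x) x x - φ (idem K x) y y with ht
  have hw := map_idem_diag_sub hφ hxy
  set E := basisElt K (.mk x y hxy) with hE
  have hsupp : ∀ s r, E s r ≠ 0 → s ≤ x ∧ y ≤ r := support_basisElt _
  have hExy : E x y = 1 := basisElt_self (.mk x y hxy)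
  set f := φ.symm E with hf
  have hφf : φ f = E := φ.apply_symm_apply E
  have hf0 : ∀ x, f x x = 0 := by
    apply apply_self_of_lie_eq_self (g := φ.symm (idem K x))
    rw [hf, ← LieEquiv.map_lie, hE, idem_lie_basisElt]
    simp [hxy.ne]
  have hmap : ∀ u v, φ ⁅idem K v, ⁅idem K u, f⁆⁆ = ⁅φ (idem K v), ⁅φ (idem K u), E⁆⁆ := by
    intro u v
    rw [LieEquiv.map_lie, LieEquiv.map_lie, hφf]
  have hval : ∀ u v, φ ⁅idem K v, ⁅idem K u, f⁆⁆ x y =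
      t * ((if v = x then 1 else 0) - (if v = y then 1 else 0)) *
        (t * ((if u = x then 1 else 0) - (if u = y then 1 else 0))) := by
    intro u v
    have h1 := lie_of_support_contains hsupp (φ (idem K u))
    rw [hmap, (lie_of_support_contains h1.1 _).2, h1.2, hw v, hw u, hExy, mul_one]
  -- If t = 0, every component of f has an image with zero (x, y) entry, although their sum f is
  -- sent to E.
  have ht0 : t ≠ 0 := by
    intro h0
    have h1 : E x y = 0 := by
      rw [← hφf, eq_sum_idem_lie_idem_lie hf0, map_neg, map_sum, IncidenceAlgebra.neg_apply,
        sum_apply, Finset.sum_eq_zero, neg_zero]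
      intro q _
      rw [hval, h0]
      ring
    rw [hExy] at h1
    exact one_ne_zero h1
  have h1 := lie_of_support_contains hsupp (φ (idem K x))
  have h2 := lie_of_support_contains h1.1 (φ (idem K y))
  have h3 := lie_of_support_contains h2.1 (φ (idem K x))
  -- The inner double bracket is a multiple of e_xy, which e_x fixes. At (x, y) its image is -t², so
  -- t(-t²) = -t².
  have h4 : ⁅idem K x, ⁅idem K y, ⁅idem K x, f⁆⁆⁆ = ⁅idem K y, ⁅idem K x, f⁆⁆ := by
    ext u v _
    rw [idem_lie_apply, idem_lie_idem_lie_apply hxy hf0]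
    by_cases h5 : x = u ∧ y = v
    · obtain ⟨rfl, rfl⟩ := h5
      simp [hxy.ne]
    · rw [if_neg h5, mul_zero]
  have h5 : t * (φ ⁅idem K y, ⁅idem K x, f⁆⁆ x y) = φ ⁅idem K y, ⁅idem K x, f⁆⁆ x y := by
    conv_rhs => rw [← h4]
    rw [LieEquiv.map_lie φ (idem K x) ⁅idem K y, _⁆, hmap, h3.2]
  rw [hval] at h5
  simp only [if_true, hxy.ne, hxy.ne', if_false] at h5
  have h6 : t * t * (t - 1) = 0 := by linear_combination -h5
  rcases mul_eq_zero.1 h6 with h | h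
  · exact absurd h (mul_ne_zero ht0 ht0)
  · exact sub_eq_zero.1 h

theorem mul_apply_of_middle_eq_zero {f g : IncidenceAlgebra K X} {u v : X} (huv : u < v)
    (h : ∀ s, u < s → s < v → f u s * g s v = 0) :
    (f * g) u v = f u u * g u v + f u v * g v v := by
  rw [IncidenceAlgebra.mul_apply, ← Finset.sum_subset (s₁ := {u, v}), Finset.sum_pair huv.ne]
  · intro x hx
    rcases Finset.mem_insert.1 hx with rfl | hx
    · exact Finset.mem_Icc.2 ⟨le_rfl, huv.le⟩
    · rw [Finset.mem_singleton.1 hx]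
      exact Finset.mem_Icc.2 ⟨huv.le, le_rfl⟩
  · intro s hs hne
    rw [Finset.mem_insert, Finset.mem_singleton, not_or] at hne
    obtain ⟨h1, h2⟩ := Finset.mem_Icc.1 hs
    exact h s (h1.lt_of_ne' hne.1) (h2.lt_of_ne hne.2)

theorem map_idem_diag [Fintype X] (hX : PosetConnected X)
    (hφ : ∀ a b c, ⁅⁅a, b⁆, φ c⁆ + ⁅⁅b, c⁆, φ a⁆ + ⁅⁅c, a⁆, φ b⁆ = 0) (w u v : X) :
    φ (idem K w) u u - φ (idem K w) v v = (if w = u then 1 else 0) - (if w = v then 1 else 0) := by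
  have := hX.eq_of_lt (d := fun u => φ (idem K w) u u - if w = u then 1 else 0)
    (fun x y hxy => by
      have h := map_idem_diag_sub hφ hxy w
      rw [map_idem_weight hφ hxy, one_mul] at h
      linear_combination h) u v
  linear_combination this

/-- The commutation of `φ e_z` and `φ e_w`, read off at `(u, v)`. -/
theorem map_idem_comm_apply [Fintype X] (hX : PosetConnected X)
    (hφ : ∀ a b c, ⁅⁅a, b⁆, φ c⁆ + ⁅⁅b, c⁆, φ a⁆ + ⁅⁅c, a⁆, φ b⁆ = 0) {u v : X} (huv : u < v)
    (h : ∀ s, u < s → s < v → ∀ w, φ (idem K w) u s = 0) (z w : X) :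
    ((if z = u then 1 else 0) - (if z = v then 1 else 0)) * φ (idem K w) u v =
      ((if w = u then 1 else 0) - (if w = v then 1 else 0)) * φ (idem K z) u v := by
  have hc : ⁅φ (idem K z), φ (idem K w)⁆ u v = 0 := by
    rw [← LieEquiv.map_lie, idem_lie_idem, map_zero, IncidenceAlgebra.zero_apply]
  rw [lie_apply, mul_apply_of_middle_eq_zero huv fun s h1 h2 => by rw [h s h1 h2, zero_mul],
    mul_apply_of_middle_eq_zero huv fun s h1 h2 => by rw [h s h1 h2, zero_mul]] at hc
  rw [← map_idem_diag hX hφ z u v, ← map_idem_diag hX hφ w u v]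
  linear_combination hc

/-- Induction on the size of [u, v]: for u < s < v the pair (u, s) is not extremal, so middle terms
vanish and commutation gives φ(e_u) + φ(e_v) = 0 at (u, v). If x < u, bracketing with e_xu kills the
entry for w ≠ x, u, in particular for w = v; then w = u follows, and then w = x. An element above v
is handled dually. -/
theorem map_idem_apply_eq_zero [Fintype X] (hX : PosetConnected X)
    (hφ : ∀ a b c, ⁅⁅a, b⁆, φ c⁆ + ⁅⁅b, c⁆, φ a⁆ + ⁅⁅c, a⁆, φ b⁆ = 0) {u v : X} (huv : u < v)
    (hext : ¬ (IsMin u ∧ IsMax v)) (w : X) : φ (idem K w) u v = 0 := by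
  induction h : (Finset.Icc u v).card using Nat.strong_induction_on generalizing u v w with
  | _ n ih =>
    subst h
    have hmid : ∀ s, u < s → s < v → ∀ w, φ (idem K w) u s = 0 := by
      intro s hus hsv w
      refine ih _ (Finset.card_lt_card ?_) hus (fun h => hsv.not_ge (h.2 hsv.le)) w rfl
      refine ⟨Finset.Icc_subset_Icc_right hsv.le, fun hss => ?_⟩
      exact hsv.not_ge (Finset.mem_Icc.1 (hss (Finset.mem_Icc.2 ⟨huv.le, le_rfl⟩))).2
    have hsum : φ (idem K v) u v + φ (idem K u) u v = 0 := by
      have := map_idem_comm_apply hX hφ huv hmid u v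
      simp only [if_true, huv.ne, huv.ne', if_false] at this
      linear_combination this
    rw [not_and_or, isMin_iff_forall_not_lt, isMax_iff_forall_not_lt] at hext
    push Not at hext
    rcases hext with ⟨x, hxu⟩ | ⟨y, hvy⟩
    · have hA : ∀ w, w ≠ x → w ≠ u → φ (idem K w) u v = 0 := by
        intro w h1 h2
        have := congrArg (fun f : IncidenceAlgebra K X => f x v)
          (basisElt_lie_map_idem_of_ne hφ hxu h1 h2)
        simp only [basisElt_lie_apply, if_true, if_neg huv.ne, sub_zero] at this
        exact this
      have hv := hA v (hxu.trans huv).ne' huv.ne'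
      have hu : φ (idem K u) u v = 0 := by linear_combination hsum - hv
      have hB := congrArg (fun f : IncidenceAlgebra K X => f x v)
        (basisElt_lie_map_idem_add hφ hxu)
      simp only [IncidenceAlgebra.add_apply, basisElt_lie_apply, if_true, if_neg huv.ne, sub_zero,
        hu, add_zero] at hB
      by_cases h1 : w = x
      · rw [h1]; exact hB
      by_cases h2 : w = u
      · rw [h2]; exact hu
      exact hA w h1 h2
    · have hA : ∀ w, w ≠ v → w ≠ y → φ (idem K w) u v = 0 := by
        intro w h1 h2
        have := congrArg (fun f : IncidenceAlgebra K X => f u y)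
          (basisElt_lie_map_idem_of_ne hφ hvy h1 h2)
        simp only [basisElt_lie_apply, if_true, if_neg huv.ne', zero_sub,
          IncidenceAlgebra.zero_apply, neg_eq_zero] at this
        exact this
      have hu := hA u huv.ne (huv.trans hvy).ne
      have hv : φ (idem K v) u v = 0 := by linear_combination hsum - hu
      have hB := congrArg (fun f : IncidenceAlgebra K X => f u y)
        (basisElt_lie_map_idem_add hφ hvy)
      simp only [IncidenceAlgebra.add_apply, basisElt_lie_apply, if_true, if_neg huv.ne', zero_sub,
        hv, neg_zero, zero_add, IncidenceAlgebra.zero_apply, neg_eq_zero] at hB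
      by_cases h1 : w = v
      · rw [h1]; exact hv
      by_cases h2 : w = y
      · rw [h2]; exact hB
      exact hA w h1 h2

open Classical in
/-- The element `b` with `b u v = φ(e_v) u v` for `u < v`. For a regular Hom-Lie structure `φ`
it is the radical part of the conjugating unit. -/
noncomputable def conjugatorPart (φ : IncidenceAlgebra K X ≃ₗ⁅K⁆ IncidenceAlgebra K X) :
    IncidenceAlgebra K X where
  toFun u v := if u < v then φ (idem K v) u v else 0
  eq_zero_of_not_le' _ _ h := if_neg fun h' => h h'.le

theorem conjugatorPart_apply {u v : X} (h : u < v) :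
    conjugatorPart φ u v = φ (idem K v) u v := if_pos h

variable [Fintype X]

theorem extremalSupport_conjugatorPart (hX : PosetConnected X)
    (hφ : ∀ a b c, ⁅⁅a, b⁆, φ c⁆ + ⁅⁅b, c⁆, φ a⁆ + ⁅⁅c, a⁆, φ b⁆ = 0) :
    ExtremalSupport (conjugatorPart φ) := by
  intro u v h
  have huv : u < v := by
    by_contra hn
    exact h (if_neg hn)
  refine ⟨huv, ?_⟩
  rw [conjugatorPart_apply huv] at h
  by_contra hext
  exact h (map_idem_apply_eq_zero hX hφ huv hext v)

theorem map_idem_eq (hX : PosetConnected X)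
    (hφ : ∀ a b c, ⁅⁅a, b⁆, φ c⁆ + ⁅⁅b, c⁆, φ a⁆ + ⁅⁅c, a⁆, φ b⁆ = 0) (x₁ z : X) :
    φ (idem K z) = idem K z +
      (φ (idem K z) x₁ x₁ - if z = x₁ then 1 else 0) • (1 : IncidenceAlgebra K X) +
      ⁅conjugatorPart φ, idem K z⁆ := by
  refine ext_lt_diag (fun x => ?_) fun u v huv => ?_
  · have := map_idem_diag hX hφ z x x₁
    rw [IncidenceAlgebra.add_apply, IncidenceAlgebra.add_apply, lie_apply_self,
      IncidenceAlgebra.constSMul_apply, IncidenceAlgebra.one_apply, if_pos rfl, idem,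
      diagElt_self, ← idem, smul_eq_mul]
    linear_combination this
  · have hmid : ∀ s, u < s → s < v → ∀ w, φ (idem K w) u s = 0 := fun s hus hsv w =>
      map_idem_apply_eq_zero hX hφ hus (fun h => hsv.not_ge (h.2 hsv.le)) w
    have := map_idem_comm_apply hX hφ huv hmid v z
    rw [← lie_skew, IncidenceAlgebra.add_apply, IncidenceAlgebra.add_apply,
      IncidenceAlgebra.neg_apply, idem_lie_apply, conjugatorPart_apply huv,
      IncidenceAlgebra.constSMul_apply, IncidenceAlgebra.one_apply, if_neg huv.ne, smul_zero,
      add_zero, ← this, if_neg huv.ne', if_pos rfl]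
    have h0 : idem K z u v = 0 := if_neg huv.ne
    rw [h0]
    ring

/-- The brackets of φ(e_w) and of e_w with g = φ(e_xy) agree, because φ(e_w) - e_w is a scalar plus
a bracket with an extremal element. So g has the weight of e_xy under all e_w, and testing w = u and
w = v leaves only the entry (x, y). -/
theorem map_basisElt_eq (hX : PosetConnected X)
    (hφ : ∀ a b c, ⁅⁅a, b⁆, φ c⁆ + ⁅⁅b, c⁆, φ a⁆ + ⁅⁅c, a⁆, φ b⁆ = 0) (p : Lt2 X) :
    φ (basisElt K p) = φ (basisElt K p) p.1.1 p.1.2 • basisElt K p := by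
  set g := φ (basisElt K p) with hg
  have hw : ∀ w, ⁅φ (idem K w), g⁆ =
      ((if w = p.1.1 then 1 else 0) - (if w = p.1.2 then 1 else 0) : K) • g := by
    intro w
    rw [hg, ← LieEquiv.map_lie, idem_lie_basisElt, map_smul]
  have hg0 : ∀ x, g x x = 0 := by
    refine apply_self_of_lie_eq_self (g := φ (idem K p.1.1)) ?_
    rw [hw, if_pos rfl, if_neg p.2.ne, sub_zero, one_smul]
  have hw' : ∀ w u v, ((if w = u then 1 else 0) - (if w = v then 1 else 0)) * g u v =
      ((if w = p.1.1 then 1 else 0) - (if w = p.1.2 then 1 else 0)) * g u v := by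
    intro w u v
    rw [← idem_lie_apply, ← smul_eq_mul _ (g u v), ← IncidenceAlgebra.constSMul_apply, ← hw w,
      map_idem_eq hX hφ p.1.1 w, add_lie, add_lie, ← lie_skew (_ • 1) g, lie_smul_one,
      ← lie_skew ⁅_, _⁆ g, (extremalSupport_conjugatorPart hX hφ).lie_lie_eq_zero hg0]
    simp
  refine ext_lt_diag (fun x => ?_) fun u v huv => ?_
  · rw [hg0, IncidenceAlgebra.constSMul_apply, basisElt_diag, smul_zero]
  · rw [IncidenceAlgebra.constSMul_apply, basisElt_apply]
    split_ifs with h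
    · rw [h]; simp
    · rw [smul_zero]
      by_contra hne
      have h1 := mul_right_cancel₀ hne (hw' u u v)
      have h2 := mul_right_cancel₀ hne (hw' v u v)
      rw [if_pos rfl, if_neg huv.ne] at h1
      rw [if_pos rfl, if_neg huv.ne'] at h2
      have hp := p.2
      obtain ⟨⟨x, y⟩, hxy⟩ := p
      dsimp only at *
      by_cases hux : u = x
      · by_cases hvy : v = y
        · exact h (by rw [hux, hvy])
        · rw [if_neg hvy, if_neg (hux ▸ huv.ne')] at h2
          simp at h2
      · rw [if_neg hux] at h1
        -- Here w = u only gives 1 = -1, no contradiction in characteristic 2. But then v > y > x,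
        -- and w = v gives -1 = 0.
        by_cases huy : u = y
        · have h3 : v ≠ x := (hxy.trans (huy ▸ huv)).ne'
          have h4 : v ≠ y := huy ▸ huv.ne'
          rw [if_neg h3, if_neg h4] at h2
          simp at h2
        · rw [if_neg huy] at h1
          simp at h1

/-- In Hom-Jacobi for e_z, e_xy, e_yz at (x, z), the term with φ(e_z) contributes its diagonal
difference 1 and the term with φ(e_xy) minus its coefficient. Replacing e_z by e_x treats e_yz. -/
theorem map_basisElt_coeff (hX : PosetConnected X)
    (hφ : ∀ a b c, ⁅⁅a, b⁆, φ c⁆ + ⁅⁅b, c⁆, φ a⁆ + ⁅⁅c, a⁆, φ b⁆ = 0) {x y z : X} (hxy : x < y)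
    (hyz : y < z) :
    φ (basisElt K (.mk x y hxy)) x y = 1 ∧ φ (basisElt K (.mk y z hyz)) y z = 1 := by
  have hxz := hxy.trans hyz
  have h1 := map_basisElt_eq hX hφ (.mk x y hxy)
  have h2 := map_basisElt_eq hX hφ (.mk y z hyz)
  dsimp only at h1 h2
  have e := basisElt_lie_basisElt (K := K) hxy hyz
  have e' : ⁅basisElt K (.mk y z hyz), basisElt K (.mk x y hxy)⁆ =
      -basisElt K (.mk x z hxz) := by rw [← e, lie_skew]
  have hself : basisElt K (.mk x z hxz) x z = 1 := basisElt_self (.mk x z hxz)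
  constructor
  · have h := congrArg (fun f : IncidenceAlgebra K X => f x z)
      (hφ (idem K z) (basisElt K (.mk x y hxy)) (basisElt K (.mk y z hyz)))
    have hd := map_idem_diag hX hφ z z x
    rw [e, idem_lie_basisElt, ← lie_skew _ (idem K z), idem_lie_basisElt, h1] at h
    simp only [hxz.ne', hyz.ne', if_true, if_false, sub_zero, zero_sub, zero_smul, zero_lie,
      neg_smul, one_smul, neg_neg, zero_add, lie_smul, e', IncidenceAlgebra.add_apply,
      IncidenceAlgebra.constSMul_apply, IncidenceAlgebra.neg_apply, IncidenceAlgebra.zero_apply,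
      basisElt_lie_apply, hself, smul_eq_mul] at h
    simp only [hxz.ne', if_true, if_false] at hd
    linear_combination -h + hd
  · have h := congrArg (fun f : IncidenceAlgebra K X => f x z)
      (hφ (idem K x) (basisElt K (.mk x y hxy)) (basisElt K (.mk y z hyz)))
    have hd := map_idem_diag hX hφ x z x
    rw [e, idem_lie_basisElt, ← lie_skew _ (idem K x), idem_lie_basisElt, h2] at h
    simp only [hxz.ne, hxy.ne, if_true, if_false, sub_zero, zero_smul, neg_zero, zero_lie,
      add_zero, one_smul, lie_smul, e, IncidenceAlgebra.add_apply,
      IncidenceAlgebra.constSMul_apply, IncidenceAlgebra.zero_apply,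
      basisElt_lie_apply, hself, smul_eq_mul] at h
    simp only [hxz.ne, if_true, if_false] at hd
    linear_combination h - hd

theorem exists_isHomLieRepresentation (hX : PosetConnected X) (x₁ : X)
    (hφ : ∀ a b c, ⁅⁅a, b⁆, φ c⁆ + ⁅⁅b, c⁆, φ a⁆ + ⁅⁅c, a⁆, φ b⁆ = 0) :
    ∃ (β : (IncidenceAlgebra K X)ˣ) (θ : Equiv.Perm (Lt2 X)) (σ : Lt2 X → Kˣ) (c : X → K),
      IsHomLieRepresentation x₁
        (φ.toLinearEquiv : IncidenceAlgebra K X →ₗ[K] IncidenceAlgebra K X) β θ σ c := by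
  have hb := extremalSupport_conjugatorPart hX hφ
  have hσ0 : ∀ p : Lt2 X, φ (basisElt K p) p.1.1 p.1.2 ≠ 0 := by
    intro p h0
    have h := map_basisElt_eq hX hφ p
    rw [h0, zero_smul] at h
    exact basisElt_ne_zero p (φ.injective (h.trans (map_zero φ).symm))
  set σ : Lt2 X → Kˣ := fun p => Units.mk0 _ (hσ0 p) with hσ
  set c : X → K := fun z => φ (idem K z) x₁ x₁ with hc
  have hrep : (φ.toLinearEquiv : IncidenceAlgebra K X →ₗ[K] IncidenceAlgebra K X) =
      xi hb.unit ∘ₗ tau x₁ (Equiv.refl _) σ c := by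
    refine linearMap_ext (fun p => ?_) fun z => ?_
    · rw [LinearMap.comp_apply, hb.xi_eq rfl, tau_refl_basisElt _ _ _ hX, hb.lie_eq_zero, add_zero]
      · exact map_basisElt_eq hX hφ p
      · intro x
        rw [IncidenceAlgebra.constSMul_apply, basisElt_diag, smul_zero]
    · rw [LinearMap.comp_apply, hb.xi_eq rfl, tau_refl_idem hX, lie_add, lie_smul_one, add_zero]
      exact map_idem_eq hX hφ x₁ z
  have hunit : (hb.unit : IncidenceAlgebra K X) = 1 + conjugatorPart φ := rfl
  have hdiag : diagPart (hb.unit : IncidenceAlgebra K X) = 1 := by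
    ext u v _
    rw [diagPart_apply, hunit, IncidenceAlgebra.add_apply, hb.apply_self,
      IncidenceAlgebra.one_apply, IncidenceAlgebra.one_apply, if_pos rfl, add_zero]
  refine ⟨hb.unit, Equiv.refl _, σ, c, ⟨admissible_refl K, monotoneOnMaxChains_refl, ?_, ?_⟩, hrep,
    rfl, ?_, hdiag, ?_⟩
  · rw [compatible_refl_iff]
    intro x y z hxy hyz
    have hxz := hxy.trans hyz
    apply Units.ext
    have h := congrArg φ (basisElt_lie_basisElt (K := K) hxy hyz)
    rw [LieEquiv.map_lie, map_basisElt_eq hX hφ (.mk x y hxy),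
      map_basisElt_eq hX hφ (.mk y z hyz), map_basisElt_eq hX hφ (.mk x z hxz), smul_lie, lie_smul,
      basisElt_lie_basisElt, smul_smul] at h
    exact (smul_left_injective K (basisElt_ne_zero _) h).symm
  · intro h0
    -- In general τ(1) = (∑ c) • 1, so a zero sum would put 1 in the kernel of φ.
    have ht : tau x₁ (Equiv.refl _) σ c (1 : IncidenceAlgebra K X) = 0 := by
      refine ext_lt_diag (fun x => ?_) fun u v huv => ?_
      · rw [tau_refl_apply_self hX]
        simp [h0]
      · rw [tau_refl_apply_of_lt _ _ _ _ huv]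
        simp [huv.ne]
    have h1 : φ 1 = 0 := by
      have := congrArg (fun g : IncidenceAlgebra K X →ₗ[K] IncidenceAlgebra K X => g 1) hrep
      simp only [LinearMap.comp_apply, ht, map_zero] at this
      exact this
    have h2 : (1 : IncidenceAlgebra K X) = 0 := φ.injective (h1.trans (map_zero φ).symm)
    have h3 := congrArg (fun f : IncidenceAlgebra K X => f x₁ x₁) h2
    simp at h3
  · intro p hp
    apply Units.ext
    obtain ⟨⟨x, y⟩, hxy⟩ := p
    rw [not_and_or, isMin_iff_forall_not_lt, isMax_iff_forall_not_lt] at hp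
    push Not at hp
    -- A non-extremal pair is one step of a chain w < x < y or x < y < w.
    rcases hp with ⟨w, hw⟩ | ⟨w, hw⟩
    · exact (map_basisElt_coeff hX hφ hw hxy).2
    · exact (map_basisElt_coeff hX hφ hxy hw).1
  · rw [mem_radicalCenter_iff, radPart, hdiag, hunit, add_sub_cancel_left]
    exact hb

end HomLieAutomorphism

end IncHomLie

theorem theorem2p11 {K X : Type*} [Field K] [PartialOrder X] [Fintype X] [DecidableEq X]
    [LocallyFiniteOrder X] [Nontrivial X] (hX : PosetConnected X) (x₁ : X)
    (φ : IncidenceAlgebra K X ≃ₗ⁅K⁆ IncidenceAlgebra K X) :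
    (IsRegularHomLieStructure
        (φ.toLinearEquiv : IncidenceAlgebra K X →ₗ[K] IncidenceAlgebra K X) ↔
      ∃ (β : (IncidenceAlgebra K X)ˣ) (θ : Equiv.Perm (Lt2 X)) (σ : Lt2 X → Kˣ) (c : X → K),
        IsHomLieRepresentation x₁
          (φ.toLinearEquiv : IncidenceAlgebra K X →ₗ[K] IncidenceAlgebra K X) β θ σ c) ∧
    (∀ (β β' : (IncidenceAlgebra K X)ˣ) (θ θ' : Equiv.Perm (Lt2 X)) (σ σ' : Lt2 X → Kˣ)
        (c c' : X → K),
      IsHomLieRepresentation x₁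
          (φ.toLinearEquiv : IncidenceAlgebra K X →ₗ[K] IncidenceAlgebra K X) β θ σ c →
      IsHomLieRepresentation x₁
          (φ.toLinearEquiv : IncidenceAlgebra K X →ₗ[K] IncidenceAlgebra K X) β' θ' σ' c' →
      β = β' ∧ θ = θ' ∧ σ = σ' ∧ c = c') := by
  refine ⟨⟨fun h => exists_isHomLieRepresentation hX x₁ h.1, ?_⟩, ?_⟩
  · rintro ⟨β, θ, σ, c, h⟩
    exact ⟨h.isHomLieStructure hX, fun a b => φ.map_lie a b, φ.bijective⟩
  · intro β β' θ θ' σ σ' c c' h h'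
    exact h.unique hX h'
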